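/- Let $\mathcal X$ be a nonempty finite set and let $\mathcal Y,\mathcal V$ be finite subsets of an abelian group. Consider a channel $\{p(y_i\mid x^i,y^{i-1})\}_{i\ge1}$ with input alphabet $\mathcal X$ and output alphabet $\mathcal Y$, whose output is fed back to the encoder, with unit delay, as $Z_i=Y_i+V_i\in\mathcal Z:=\mathcal Y+\mathcal V$. Here the noise $V$ is a $\mathcal V$-valued process with law $\{p(v_i\mid v^{i-1})\}_{i\ge1}$ that is independent of the message and of the forward channel; so an input distribution $\{p(x_i\mid x^{i-1},z^{i-1})\}_{i\le n}$ determines the joint law $$p(x^n,y^n,v^n)=\prod_{i=1}^n p(x_i\mid x^{i-1},y^{i-1}+v^{i-1})\,p(y_i\mid x^i,y^{i-1})\,p(v_i\mid v^{i-1}),\qquad z^n=y^n+v^n .$$ Logarithms are to base $2$. Put $$I(X^n\to Y^n\|Z^n)=\mathbb E\log\frac{\prod_{i=1}^n p(Y_i\mid X^i,Y^{i-1},Z^{i-1})}{\prod_{i=1}^n p(Y_i\mid Y^{i-1},Z^{i-1})},\qquad I(X^n\to Y^n\mid V^n)=\sum_{i=1}^n I(X^i;Y_i\mid Y^{i-1},V^n).$$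 A code for $M\ge 1$ messages and horizon $n$ consists of maps $x_i=f_i[w](z^{i-1})$ ($1\le i\le n$, $1\le w\le M$) and a decoder $\mathcal Y^n\to\{1,\dots,M\}$. A rate $R\ge0$ is achievable if for every $\varepsilon>0$ and all sufficiently large $n$ there is such a code with $\frac1n\log M\ge R-\varepsilon$ and average error probability at most $\varepsilon$. The capacity $C_{FB}^{noise}$ is the supremum of the achievable rates. Let $$\bar C_{FB}^{noise}=\sup_X\liminf_{n\to\infty}\frac1n I(X^n\to Y^n\|Z^n),$$ where the supremum is over all families of channel input distributions that contain, for every horizon $n$, a distribution $\{p_n(x_i\mid x^{i-1},z^{i-1})\}_{i=1}^n$. Then $\bar C_{FB}^{noise}$ is an upper bound on the capacity, and it can be computed with ordinary conditioning on the noise: $$C_{FB}^{noise}\le \bar C_{FB}^{noise}=\sup_X\liminf_{n\to\infty}\frac1n I(X^n\to Y^n\mid V^n),$$ with the supremum over the same families, $\{p_n(x_i\mid x^{i-1},y^{i-1}+v^{i-1})\}_{i=1}^n$, $n\ge 1$. Likewise $$\sup_X\liminf_{n\to\infty}\frac1n I(X^n\to Y^n\|Z^n)=\sup_X\liminf_{n\to\infty}\frac1n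 I(X^n\to Y^n\mid V^n)$$ if both suprema are restricted to single sequences $\{p(x_i\mid x^{i-1},z^{i-1})\}_{i=1}^\infty$ that are used for all horizons $n$. -/

import Mathlib

open Filter
open scoped Pointwise

noncomputable section

namespace NoisyFeedback

/-! Sequences `x_1, …, x_n` are functions on `Fin n`, so time is counted from `0`.
For `i : Fin n`, the tuple of the entries strictly before time `i` is `past x i` and the tuple of
the entries up to and including time `i` is `upTo x i`. -/

/-- The entries of `x` strictly before time `i` (in the usual notation, `x^{i-1}`). -/
def past {α : Type*} {n : ℕ} (x : Fin n → α) (i : Fin n) : Fin i → α :=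
  fun j => x (Fin.castLE i.isLt.le j)

/-- The entries of `x` up to and including time `i` (in the usual notation, `x^i`). -/
def upTo {α : Type*} {n : ℕ} (x : Fin n → α) (i : Fin n) : Fin (i + 1) → α :=
  fun j => x (Fin.castLE i.isLt j)

/-! ### Information measures on a finite probability space, in bits -/

section Information

variable {Ω : Type*} [Fintype Ω] {α β γ 𝒳 𝒴 𝒵 : Type*}

open Classical in
/-- The probability that the random variable `A` takes the value `a`, when the probability mass
function on `Ω` is `μ`. -/
def prob (μ : Ω → ℝ) (A : Ω → α) (a : α) : ℝ :=
  ∑ ω, if A ω = a then μ ω else 0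

/-- The conditional probability `p(B | C)`, evaluated at the outcome `ω`, that is, the number
`P(B = B ω, C = C ω) / P(C = C ω)`. -/
def condProb (μ : Ω → ℝ) (B : Ω → β) (C : Ω → γ) (ω : Ω) : ℝ :=
  prob μ (fun ω' => (B ω', C ω')) (B ω, C ω) / prob μ C (C ω)

/-- Conditional mutual information `I(A; B | C) = E log (p(A, B | C) / (p(A | C) p(B | C)))`. -/
def condMutualInfo (μ : Ω → ℝ) (A : Ω → α) (B : Ω → β) (C : Ω → γ) : ℝ :=
  ∑ ω, μ ω * Real.logb 2
    (condProb μ (fun ω' => (A ω', B ω')) C ω / (condProb μ A C ω * condProb μ B C ω))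

/-- Causal conditional directed information `I(X^n → Y^n ‖ Z^n)` for the time ordering
`X_1, Y_1, Z_1, X_2, Y_2, Z_2, …`: the expectation of
`log (∏ p(Y_i | X^i, Y^{i-1}, Z^{i-1}) / ∏ p(Y_i | Y^{i-1}, Z^{i-1}))`. -/
def causalCondDirectedInfo {n : ℕ} (μ : Ω → ℝ)
    (X : Ω → Fin n → 𝒳) (Y : Ω → Fin n → 𝒴) (Z : Ω → Fin n → 𝒵) : ℝ :=
  ∑ ω, μ ω * Real.logb 2
    ((∏ i : Fin n, condProb μ (fun ω' => Y ω' i)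
        (fun ω' => (upTo (X ω') i, past (Y ω') i, past (Z ω') i)) ω) /
      (∏ i : Fin n, condProb μ (fun ω' => Y ω' i)
        (fun ω' => (past (Y ω') i, past (Z ω') i)) ω))

/-- Directed information with ordinary conditioning on the whole sequence `V^n`,
`I(X^n → Y^n | V^n) = ∑ I(X^i; Y_i | Y^{i-1}, V^n)`. -/
def condDirectedInfo {n : ℕ} (μ : Ω → ℝ)
    (X : Ω → Fin n → 𝒳) (Y : Ω → Fin n → 𝒴) (V : Ω → Fin n → 𝒵) : ℝ :=
  ∑ i : Fin n, condMutualInfo μ (fun ω => upTo (X ω) i) (fun ω => Y ω i)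
    (fun ω => (past (Y ω) i, V ω))

end Information

/-! ### Channels with noisy feedback -/

/-- A channel `{p(y_i | x^i, y^{i-1})}`. -/
def Channel (𝒳 𝒴 : Type*) : Type _ :=
  (i : ℕ) → (Fin (i + 1) → 𝒳) → (Fin i → 𝒴) → PMF 𝒴

/-- A feedback link `{p(z_i | y^i, z^{i-1})}`. -/
def FeedbackLink (𝒴 𝒵 : Type*) : Type _ :=
  (i : ℕ) → (Fin (i + 1) → 𝒴) → (Fin i → 𝒵) → PMF 𝒵

/-- A channel input distribution `{p(x_i | x^{i-1}, z^{i-1})}` with `i` ranging over the first `n`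
time instants. -/
def BlockInput (𝒳 𝒵 : Type*) (n : ℕ) : Type _ :=
  (i : Fin n) → (Fin i → 𝒳) → (Fin i → 𝒵) → PMF 𝒳

/-- A channel input distribution `{p(x_i | x^{i-1}, z^{i-1})}` with `i` ranging over all time
instants. -/
def SeqInput (𝒳 𝒵 : Type*) : Type _ :=
  (i : ℕ) → (Fin i → 𝒳) → (Fin i → 𝒵) → PMF 𝒳

/-- The part of an input distribution that concerns the first `n` time instants. -/
def SeqInput.block {𝒳 𝒵 : Type*} (P : SeqInput 𝒳 𝒵) (n : ℕ) : BlockInput 𝒳 𝒵 n :=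
  fun i => P i

/-- The law of a noise sequence, `{p(v_i | v^{i-1})}`. -/
def NoiseLaw (𝒱 : Type*) : Type _ :=
  (i : ℕ) → (Fin i → 𝒱) → PMF 𝒱

/-- The joint law of `(X^n, Y^n, Z^n)`,
`∏ p(x_i | x^{i-1}, z^{i-1}) p(y_i | x^i, y^{i-1}) p(z_i | y^i, z^{i-1})`. -/
def jointLaw {𝒳 𝒴 𝒵 : Type*} (channel : Channel 𝒳 𝒴) (link : FeedbackLink 𝒴 𝒵) {n : ℕ}
    (P : BlockInput 𝒳 𝒵 n) (ω : (Fin n → 𝒳) × (Fin n → 𝒴) × (Fin n → 𝒵)) : ℝ :=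
  ∏ i : Fin n,
    (P i (past ω.1 i) (past ω.2.2 i) (ω.1 i)).toReal *
    (channel i (upTo ω.1 i) (past ω.2.1 i) (ω.2.1 i)).toReal *
    (link i (upTo ω.2.1 i) (past ω.2.2 i) (ω.2.2 i)).toReal

section Capacity

variable {𝒳 𝒴 𝒵 : Type*} [Fintype 𝒳] [Fintype 𝒴] [Fintype 𝒵]

/-- An encoder and a decoder for the message set `Fin M` and the time horizon `n`: every message
has a code-function, a sequence of maps `z^{i-1} ↦ x_i`. -/
structure Code (𝒳 𝒴 𝒵 : Type*) (n M : ℕ) where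
  /-- the code-functions, one for each message -/
  enc : Fin M → (i : Fin n) → (Fin i → 𝒵) → 𝒳
  /-- the decoder -/
  dec : (Fin n → 𝒴) → Fin M

/-- The (degenerate) input distribution that a code-function induces. -/
def codeFunctionInput {n : ℕ} (f : (i : Fin n) → (Fin i → 𝒵) → 𝒳) : BlockInput 𝒳 𝒵 n :=
  fun i _ z => PMF.pure (f i z)

/-- The error probability of a code, averaged over the messages. -/
def Code.avgError (channel : Channel 𝒳 𝒴) (link : FeedbackLink 𝒴 𝒵) {n M : ℕ}
    (c : Code 𝒳 𝒴 𝒵 n M) : ℝ :=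
  (1 / (M : ℝ)) * ∑ w : Fin M,
    ∑ ω : (Fin n → 𝒳) × (Fin n → 𝒴) × (Fin n → 𝒵),
      if c.dec ω.2.1 ≠ w then jointLaw channel link (codeFunctionInput (c.enc w)) ω else 0

/-- The rate `R ≥ 0` is achievable: for every `ε > 0` and all sufficiently large `n` there is a
code with error probability at most `ε` and rate at least `R - ε`. -/
def Achievable (channel : Channel 𝒳 𝒴) (link : FeedbackLink 𝒴 𝒵) (R : ℝ) : Prop :=
  0 ≤ R ∧ ∀ ε : ℝ, 0 < ε → ∀ᶠ n : ℕ in atTop,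
    ∃ M : ℕ, 0 < M ∧ R - ε ≤ Real.logb 2 M / n ∧
      ∃ c : Code 𝒳 𝒴 𝒵 n M, c.avgError channel link ≤ ε

/-- The capacity of a channel with noisy feedback, in bits per channel use. -/
def capacity (channel : Channel 𝒳 𝒴) (link : FeedbackLink 𝒴 𝒵) : EReal :=
  ⨆ R : {R : ℝ // Achievable channel link R}, ((R : ℝ) : EReal)

/-- `liminf (1/n) I(X^n → Y^n ‖ Z^n)`, where for every `n` the input distribution for the time
horizon `n` is `P n`. -/
def causalRate (channel : Channel 𝒳 𝒴) (link : FeedbackLink 𝒴 𝒵)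
    (P : (n : ℕ) → BlockInput 𝒳 𝒵 n) : EReal :=
  liminf (fun n : ℕ => (((1 / (n : ℝ)) * causalCondDirectedInfo (jointLaw channel link (P n))
    (fun ω => ω.1) (fun ω => ω.2.1) (fun ω => ω.2.2) : ℝ) : EReal)) atTop

end Capacity

/-! ### Independent additive noise in the feedback link -/

section AdditiveNoise

variable {𝒳 : Type*} [Fintype 𝒳] {G : Type*} [AddCommGroup G] [DecidableEq G] {𝒴 𝒱 : Finset G}

/-- The entrywise sum `y + v` of two sequences, in the alphabet `𝒴 + 𝒱`. -/
def addSeq {n : ℕ} (y : Fin n → 𝒴) (v : Fin n → 𝒱) : Fin n → ↥(𝒴 + 𝒱) :=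
  fun i => ⟨(y i : G) + (v i : G), Finset.add_mem_add (y i).2 (v i).2⟩

/-- The feedback link is `Z_i = Y_i + V_i` with a noise that has the given law and is independent
of everything else: for all `y^i` and `v^i`, the probability of `z_i = y_i + v_i` given `y^i` and
`z^{i-1} = y^{i-1} + v^{i-1}` is `p(v_i | v^{i-1})`. -/
def IsAdditiveNoiseLink (link : FeedbackLink 𝒴 ↥(𝒴 + 𝒱)) (noise : NoiseLaw 𝒱) : Prop :=
  ∀ (i : ℕ) (y : Fin (i + 1) → 𝒴) (v : Fin (i + 1) → 𝒱),
    link i y (past (addSeq y v) (Fin.last i)) (addSeq y v (Fin.last i)) =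
      noise i (past v (Fin.last i)) (v (Fin.last i))

/-- The joint law of `(X^n, Y^n, V^n)` when the feedback is `Y + V`,
`∏ p(x_i | x^{i-1}, y^{i-1} + v^{i-1}) p(y_i | x^i, y^{i-1}) p(v_i | v^{i-1})`. -/
def additiveJointLaw (channel : Channel 𝒳 𝒴) (noise : NoiseLaw 𝒱) {n : ℕ}
    (P : BlockInput 𝒳 ↥(𝒴 + 𝒱) n) (ω : (Fin n → 𝒳) × (Fin n → 𝒴) × (Fin n → 𝒱)) : ℝ :=
  ∏ i : Fin n,
    (P i (past ω.1 i) (past (addSeq ω.2.1 ω.2.2) i) (ω.1 i)).toReal *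
    (channel i (upTo ω.1 i) (past ω.2.1 i) (ω.2.1 i)).toReal *
    (noise i (past ω.2.2 i) (ω.2.2 i)).toReal

/-- `liminf (1/n) I(X^n → Y^n | V^n)`, where for every `n` the input distribution for the time
horizon `n` is `P n`. -/
def noiseCondRate (channel : Channel 𝒳 𝒴) (noise : NoiseLaw 𝒱)
    (P : (n : ℕ) → BlockInput 𝒳 ↥(𝒴 + 𝒱) n) : EReal :=
  liminf (fun n : ℕ => (((1 / (n : ℝ)) * condDirectedInfo (additiveJointLaw channel noise (P n))
    (fun ω => ω.1) (fun ω => ω.2.1) (fun ω => ω.2.2) : ℝ) : EReal)) atTop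

end AdditiveNoise

end NoisyFeedback

end

/-! The equalities hold for each input distribution and each horizon. Given `y^{i-1}`, the tuples
`z^{i-1} = y^{i-1} + v^{i-1}` and `v^{i-1}` determine each other, so conditioning on past feedback
is conditioning on past noise. The joint law is the law of `v^n` times factors that, up to time `i`,
involve only `v^{i-1}`; hence `Y_i` is conditionally independent of the present and future noise,
with or without `X^i` in the condition (`condProb_eq_of_factor`). So `V^{i-1}` may be replaced by
`V^n`, and the two log-ratios agree outcome by outcome (`causalCondDirectedInfo_eq`).

For the capacity bound, a code with a uniform message induces an input distribution, `mixedInput`,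
under which `(X, Y, V)` has the law averaged over the messages. Its information is `E log (p(y‖x)
p(v) / p(y, v))`, which splits into a relative entropy and the expectation of `log (M q(w | y))`,
for a guess `q` built from the decoder. Gibbs' inequality discards the former; the latter is at
least `(1 - error) log M - 1` (`fano`). Dividing by `n` and choosing one code per horizon bounds
every achievable rate (`achievable_le`). -/

noncomputable section

namespace NoisyFeedback

/-! ### Masses of events on a finite probability space -/

section Mass

variable {Ω : Type*} [Fintype Ω] {α β γ δ : Type*}

open Classical in
/-- The mass of the event `p`. -/
def mass (μ : Ω → ℝ) (p : Ω → Prop) : ℝ := ∑ ω, if p ω then μ ω else 0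

theorem prob_eq_mass (μ : Ω → ℝ) (A : Ω → α) (a : α) : prob μ A a = mass μ (fun ω => A ω = a) :=
  rfl

theorem mass_congr (μ : Ω → ℝ) {p q : Ω → Prop} (h : ∀ ω, p ω ↔ q ω) : mass μ p = mass μ q := by
  rw [show p = q from funext fun ω => propext (h ω)]

theorem mass_eq_sum [Fintype α] (μ : Ω → ℝ) (p : Ω → Prop) (A : Ω → α) :
    mass μ p = ∑ a, mass μ (fun ω => A ω = a ∧ p ω) := by
  classical
  unfold mass
  rw [Finset.sum_comm]
  refine Finset.sum_congr rfl fun ω _ => ?_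
  rw [Finset.sum_eq_single (A ω)]
  · simp
  · intro b _ hb
    simp [hb.symm]
  · simp

theorem mass_pos {μ : Ω → ℝ} (hμ : ∀ ω, 0 ≤ μ ω) {p : Ω → Prop} {ω : Ω} (hω : 0 < μ ω)
    (hp : p ω) : 0 < mass μ p := by
  classical
  refine Finset.sum_pos' (fun ω' _ => ?_) ⟨ω, Finset.mem_univ _, by simpa [hp] using hω⟩
  split_ifs
  exacts [hμ ω', le_rfl]

theorem condProb_eq_mass (μ : Ω → ℝ) (B : Ω → β) (C : Ω → γ) (ω : Ω) :
    condProb μ B C ω =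
      mass μ (fun ω' => B ω' = B ω ∧ C ω' = C ω) / mass μ (fun ω' => C ω' = C ω) := by
  unfold condProb
  rw [prob_eq_mass, prob_eq_mass]
  congr 1
  exact mass_congr μ fun ω' => Prod.mk_inj

theorem condProb_congr_right (μ : Ω → ℝ) (B : Ω → β) {C : Ω → γ} {C' : Ω → δ} {ω : Ω}
    (h : ∀ ω', C ω' = C ω ↔ C' ω' = C' ω) : condProb μ B C ω = condProb μ B C' ω := by
  simp only [condProb_eq_mass, h]

theorem condProb_pos {μ : Ω → ℝ} (hμ : ∀ ω, 0 ≤ μ ω) (B : Ω → β) (C : Ω → γ) {ω : Ω}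
    (hω : 0 < μ ω) : 0 < condProb μ B C ω := by
  rw [condProb_eq_mass]
  exact div_pos (mass_pos hμ hω ⟨rfl, rfl⟩) (mass_pos hμ hω rfl)

/-- If the joint law of `(B, C, V)` is `N(v) g(b, c, v)`, where `g` depends on `v` only through
`u(v)`, then `B` and `V` are conditionally independent given `(C, u(V))`. -/
theorem condProb_eq_of_factor [Fintype β] [Fintype γ] {μ : Ω → ℝ} (hμ : ∀ ω, 0 ≤ μ ω)
    (B : Ω → β) (C : Ω → α) (V : Ω → γ) (u : γ → δ) (N : γ → ℝ) (g : β → α → γ → ℝ)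
    (hfac : ∀ b c v, mass μ (fun ω => B ω = b ∧ C ω = c ∧ V ω = v) = N v * g b c v)
    (hg : ∀ b c v v', u v = u v' → g b c v = g b c v') {ω : Ω} (hω : 0 < μ ω) :
    condProb μ B (fun ω => (C ω, V ω)) ω = condProb μ B (fun ω => (C ω, u (V ω))) ω := by
  classical
  have hCV : ∀ c v, mass μ (fun ω => C ω = c ∧ V ω = v) = N v * ∑ b, g b c v := fun c v => by
    rw [mass_eq_sum μ _ B, Finset.mul_sum]
    exact Finset.sum_congr rfl fun b _ => hfac b c v
  have hU : ∀ (p : Ω → Prop) (G : γ → ℝ) (v₀ : γ),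
      (∀ v, mass μ (fun ω => p ω ∧ V ω = v) = N v * G v) → (∀ v, u v = u v₀ → G v = G v₀) →
      mass μ (fun ω => p ω ∧ u (V ω) = u v₀) = (∑ v, if u v = u v₀ then N v else 0) * G v₀ := by
    intro p G v₀ h₁ h₂
    rw [mass_eq_sum μ _ V, Finset.sum_mul]
    refine Finset.sum_congr rfl fun v _ => ?_
    split_ifs with h
    · rw [← h₂ v h, ← h₁ v]
      refine mass_congr μ fun ω' => ⟨fun k => ⟨k.2.1, k.1⟩, fun k => ⟨k.2, k.1, ?_⟩⟩
      rw [k.2, h]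
    · rw [zero_mul]
      refine Finset.sum_eq_zero fun ω' _ => if_neg ?_
      rintro ⟨k₁, -, k₂⟩
      exact h (k₁ ▸ k₂)
  have e₁ : mass μ (fun ω' => C ω' = C ω ∧ u (V ω') = u (V ω)) =
      (∑ v, if u v = u (V ω) then N v else 0) * ∑ b, g b (C ω) (V ω) :=
    hU _ (fun v => ∑ b, g b (C ω) v) _ (fun v => hCV _ v)
      (fun v hv => Finset.sum_congr rfl fun b _ => hg b _ _ _ hv)
  have e₂ : mass μ (fun ω' => (B ω' = B ω ∧ C ω' = C ω) ∧ u (V ω') = u (V ω)) =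
      (∑ v, if u v = u (V ω) then N v else 0) * g (B ω) (C ω) (V ω) :=
    hU _ (fun v => g (B ω) (C ω) v) _
      (fun v => (mass_congr μ fun _ => and_assoc).trans (hfac _ _ v)) (fun v hv => hg _ _ _ _ hv)
  -- Positive mass makes both noise factors nonzero. They cancel, and both conditional probabilities
  -- become `g / ∑ b, g`.
  have p₁ : 0 < N (V ω) * ∑ b, g b (C ω) (V ω) := by
    rw [← hCV]
    exact mass_pos hμ hω ⟨rfl, rfl⟩
  have p₂ : 0 < (∑ v, if u v = u (V ω) then N v else 0) * ∑ b, g b (C ω) (V ω) := by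
    rw [← e₁]
    exact mass_pos hμ hω ⟨rfl, rfl⟩
  simp only [condProb_eq_mass, Prod.mk_inj]
  rw [e₁, hCV, hfac, ← mass_congr μ (fun _ => and_assoc), e₂,
    mul_div_mul_left _ _ (left_ne_zero_of_mul p₁.ne'),
    mul_div_mul_left _ _ (left_ne_zero_of_mul p₂.ne')]

/-- Bayes' rule, `p(A, B | C) = p(A | C) p(B | A, C)`, at outcomes of positive mass; the others
contribute zero. -/
theorem condMutualInfo_eq {μ : Ω → ℝ} (hμ : ∀ ω, 0 ≤ μ ω) (A : Ω → α) (B : Ω → β) (C : Ω → γ) :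
    condMutualInfo μ A B C = ∑ ω, μ ω *
      (Real.logb 2 (condProb μ B (fun ω => (A ω, C ω)) ω) - Real.logb 2 (condProb μ B C ω)) := by
  unfold condMutualInfo
  refine Finset.sum_congr rfl fun ω _ => ?_
  rcases (hμ ω).eq_or_lt with h | h
  · simp [← h]
  rw [← Real.logb_div (condProb_pos hμ B _ h).ne' (condProb_pos hμ B _ h).ne']
  congr 2
  have h₁ := mass_pos hμ (p := fun ω' => C ω' = C ω) h rfl
  have h₂ := mass_pos hμ (p := fun ω' => A ω' = A ω ∧ C ω' = C ω) h ⟨rfl, rfl⟩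
  have h₃ := mass_pos hμ (p := fun ω' => B ω' = B ω ∧ C ω' = C ω) h ⟨rfl, rfl⟩
  have h₄ : mass μ (fun ω' => (A ω' = A ω ∧ B ω' = B ω) ∧ C ω' = C ω) =
      mass μ (fun ω' => B ω' = B ω ∧ A ω' = A ω ∧ C ω' = C ω) :=
    mass_congr μ fun ω' => by tauto
  simp only [condProb_eq_mass, Prod.mk_inj, h₄]
  field_simp

/-- Directed information with ordinary conditioning as the expectation of a log-ratio. -/
theorem condDirectedInfo_eq {𝒳 𝒴 𝒵 : Type*} {n : ℕ} {μ : Ω → ℝ} (hμ : ∀ ω, 0 ≤ μ ω)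
    (X : Ω → Fin n → 𝒳) (Y : Ω → Fin n → 𝒴) (V : Ω → Fin n → 𝒵) :
    condDirectedInfo μ X Y V = ∑ ω, μ ω * Real.logb 2
      ((∏ i, condProb μ (fun ω => Y ω i)
          (fun ω => ((upTo (X ω) i, past (Y ω) i), V ω)) ω) /
        ∏ i, condProb μ (fun ω => Y ω i) (fun ω => (past (Y ω) i, V ω)) ω) := by
  unfold condDirectedInfo
  simp only [condMutualInfo_eq hμ]
  rw [Finset.sum_comm]
  refine Finset.sum_congr rfl fun ω _ => ?_
  rcases (hμ ω).eq_or_lt with h | h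
  · simp [← h]
  rw [← Finset.mul_sum, Finset.sum_sub_distrib,
    Real.logb_div (Finset.prod_pos fun i _ => condProb_pos hμ _ _ h).ne'
      (Finset.prod_pos fun i _ => condProb_pos hμ _ _ h).ne',
    Real.logb_prod _ _ (fun i _ => (condProb_pos hμ _ _ h).ne'),
    Real.logb_prod _ _ (fun i _ => (condProb_pos hμ _ _ h).ne')]
  congr 2
  refine Finset.sum_congr rfl fun i _ => ?_
  congr 1
  exact condProb_congr_right μ _ fun ω' => by simp only [Prod.mk_inj, and_assoc]

/-- Gibbs' inequality. -/
theorem sum_mul_logb_div_nonneg {ρ t : Ω → ℝ} (hρ : ∀ ω, 0 ≤ ρ ω) (ht : ∀ ω, 0 ≤ t ω)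
    (hρt : ∀ ω, 0 < ρ ω → 0 < t ω) (hsum : ∑ ω, t ω ≤ ∑ ω, ρ ω) :
    0 ≤ ∑ ω, ρ ω * Real.logb 2 (ρ ω / t ω) := by
  have h2 : 0 < Real.log 2 := Real.log_pos one_lt_two
  -- The pointwise bound comes from `log x ≥ 1 - 1/x` at `x = ρ/t`.
  have key : ∀ ω, (ρ ω - t ω) / Real.log 2 ≤ ρ ω * Real.logb 2 (ρ ω / t ω) := fun ω => by
    rcases (hρ ω).eq_or_lt with h | h
    · rw [← h]
      simpa using div_nonpos_of_nonpos_of_nonneg (neg_nonpos.2 (ht ω)) h2.le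
    · have ht' := hρt ω h
      rw [Real.logb, ← mul_div_assoc]
      gcongr
      have h3 := Real.one_sub_inv_le_log_of_pos (div_pos h ht')
      calc ρ ω - t ω = ρ ω * (1 - (ρ ω / t ω)⁻¹) := by field_simp
        _ ≤ _ := by gcongr
  refine le_trans ?_ (Finset.sum_le_sum fun ω _ => key ω)
  rw [← Finset.sum_div, Finset.sum_sub_distrib]
  exact div_nonneg (sub_nonneg.2 hsum) h2.le

end Mass

/-! ### Sequences -/

theorem prod_eq_of_telescope {n : ℕ} (r : ℕ → ℝ) (p : Fin n → ℝ)
    (h : ∀ i : Fin n, r (i + 1) = r i * p i) : r n = r 0 * ∏ i, p i := by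
  induction n with
  | zero => simp
  | succ n ih =>
    rw [Fin.prod_univ_castSucc, ← mul_assoc, ← ih (fun i => p i.castSucc) fun i => h i.castSucc]
    exact h (Fin.last n)

theorem sum_snoc {α : Type*} [Fintype α] {n : ℕ} (f : (Fin (n + 1) → α) → ℝ) :
    ∑ x, f x = ∑ x : Fin n → α, ∑ a, f (Fin.snoc x a) := by
  classical
  rw [← (Fin.snocEquiv fun _ : Fin (n + 1) => α).sum_comp, Fintype.sum_prod_type,
    Finset.sum_comm]
  rfl

theorem snoc_castLE {α : Type*} {m n : ℕ} (h : m ≤ n) (x : Fin n → α) (a : α) (k : Fin m) :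
    (Fin.snoc x a : Fin (n + 1) → α) (Fin.castLE (h.trans n.le_succ) k) = x (Fin.castLE h k) :=
  Fin.snoc_castSucc (α := fun _ => α) a x (Fin.castLE h k)

theorem upTo_snoc {α : Type*} {n : ℕ} (x : Fin n → α) (a : α) (i : Fin n) :
    upTo (Fin.snoc x a : Fin (n + 1) → α) i.castSucc = upTo x i :=
  funext fun k => snoc_castLE i.isLt x a k

theorem upTo_last {α : Type*} {n : ℕ} (x : Fin (n + 1) → α) : upTo x (Fin.last n) = x :=
  rfl

/-- The marginal law of the first `m` entries of a pair of sequences whose joint law is a product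
of conditional probabilities. -/
theorem sum_truncate {α β : Type*} [Fintype α] [Fintype β] {n : ℕ}
    (W : (i : Fin n) → (Fin (i + 1) → α) → (Fin (i + 1) → β) → ℝ)
    (hW : ∀ (i : Fin n) (x : Fin i → α) (y : Fin i → β),
      ∑ a, ∑ b, W i (Fin.snoc x a) (Fin.snoc y b) = 1)
    {m : ℕ} (hm : m ≤ n) (F : (Fin m → α) → (Fin m → β) → ℝ) :
    ∑ x : Fin n → α, ∑ y : Fin n → β,
        F (fun k => x (Fin.castLE hm k)) (fun k => y (Fin.castLE hm k)) *
          ∏ i : Fin n, W i (upTo x i) (upTo y i) =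
      ∑ x : Fin m → α, ∑ y : Fin m → β,
        F x y * ∏ i : Fin m, W (Fin.castLE hm i) (upTo x i) (upTo y i) := by
  induction n, hm using Nat.le_induction with
  | base => rfl
  | succ n hmn ih =>
    refine Eq.trans ?_ (ih (fun i : Fin n => W i.castSucc) (fun i : Fin n => hW i.castSucc))
    rw [sum_snoc]
    refine Finset.sum_congr rfl fun x _ => ?_
    simp_rw [sum_snoc (α := β)]
    rw [Finset.sum_comm]
    refine Finset.sum_congr rfl fun y _ => ?_
    simp_rw [Fin.prod_univ_castSucc, snoc_castLE hmn, upTo_snoc, upTo_last, ← mul_assoc, ← Finset.mul_sum]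
    -- Only the last factor involves the two final entries, and it sums to one.
    rw [hW (Fin.last n) x y, mul_one]

theorem past_snoc {α : Type*} {n : ℕ} (x : Fin n → α) (a : α) :
    past (Fin.snoc x a : Fin (n + 1) → α) (Fin.last n) = x :=
  funext fun k => Fin.snoc_castSucc (α := fun _ => α) a x k

theorem snoc_past_eq_upTo {α : Type*} {n : ℕ} (x : Fin n → α) (i : Fin n) :
    (Fin.snoc (past x i) (x i) : Fin (i + 1) → α) = upTo x i := by
  funext k
  refine Fin.lastCases ?_ (fun k => ?_) k
  · rw [Fin.snoc_last]
    rfl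
  · rw [Fin.snoc_castSucc]
    rfl

theorem upTo_eq_snoc_iff {α : Type*} {n : ℕ} (x : Fin n → α) (i : Fin n) (a : Fin i → α) (b : α) :
    upTo x i = (Fin.snoc a b : Fin (i + 1) → α) ↔ x i = b ∧ past x i = a := by
  rw [← snoc_past_eq_upTo, Fin.snoc_inj, and_comm]

/-- In this form the bound `i` may be replaced by any natural number, as telescoping from `0` to `n`
requires. -/
theorem past_eq_past_iff {α : Type*} {n : ℕ} (x x' : Fin n → α) (i : Fin n) :
    past x i = past x' i ↔ ∀ k : Fin n, (k : ℕ) < i → x k = x' k :=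
  ⟨fun h k hk => congrFun h ⟨k, hk⟩, fun h => funext fun k => h (Fin.castLE i.isLt.le k) k.isLt⟩

/-- The chain rule for conditional probabilities. -/
theorem prod_condProb_eq {Ω β γ : Type*} [Fintype Ω] {n : ℕ} {μ : Ω → ℝ} (hμ : ∀ ω, 0 ≤ μ ω)
    (Y : Ω → Fin n → β) (V : Ω → γ) {ω : Ω} (hω : 0 < μ ω) :
    ∏ i, condProb μ (fun ω => Y ω i) (fun ω => (past (Y ω) i, V ω)) ω =
      mass μ (fun ω' => Y ω' = Y ω ∧ V ω' = V ω) / mass μ (fun ω' => V ω' = V ω) := by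
  have h := prod_eq_of_telescope
    (fun m => mass μ fun ω' => (∀ k : Fin n, (k : ℕ) < m → Y ω' k = Y ω k) ∧ V ω' = V ω)
    (fun i => condProb μ (fun ω => Y ω i) (fun ω => (past (Y ω) i, V ω)) ω) fun i => by
      have h₀ := mass_pos hμ hω (p := fun ω' =>
        (∀ k : Fin n, (k : ℕ) < i → Y ω' k = Y ω k) ∧ V ω' = V ω) ⟨fun _ _ => rfl, rfl⟩
      simp only [condProb_eq_mass, Prod.mk_inj, past_eq_past_iff]
      rw [mul_div_cancel₀ _ h₀.ne']
      refine mass_congr μ fun ω' => ⟨fun h => ⟨h.1 i (Nat.lt_succ_self _),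
        fun k hk => h.1 k (Nat.lt_succ_of_lt hk), h.2⟩, fun h => ⟨fun k hk => ?_, h.2.2⟩⟩
      rcases (Nat.lt_succ_iff_lt_or_eq.1 hk) with hk | hk
      · exact h.2.1 k hk
      · rw [Fin.ext hk]
        exact h.1
  have h0 : mass μ (fun ω' => (∀ k : Fin n, (k : ℕ) < 0 → Y ω' k = Y ω k) ∧ V ω' = V ω) =
      mass μ (fun ω' => V ω' = V ω) := mass_congr μ fun ω' => by simp
  have hn : mass μ (fun ω' => (∀ k : Fin n, (k : ℕ) < n → Y ω' k = Y ω k) ∧ V ω' = V ω) =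
      mass μ (fun ω' => Y ω' = Y ω ∧ V ω' = V ω) := mass_congr μ fun ω' => by simp [funext_iff]
  simp only [h0, hn] at h
  rw [h, mul_div_cancel_left₀ _ (mass_pos hμ hω (p := fun ω' => V ω' = V ω) rfl).ne']

theorem PMF_sum_toReal {α : Type*} [Fintype α] (p : PMF α) : ∑ a, (p a).toReal = 1 := by
  rw [← ENNReal.toReal_sum fun a _ => p.apply_ne_top a, ← tsum_fintype (L := .unconditional _),
    p.tsum_coe, ENNReal.toReal_one]

/-! ### The joint law of input, output and additive noise -/

/-- The law of the noise sequence. -/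
def noiseWeight {α : Type*} (noise : NoiseLaw α) {n : ℕ} (v : Fin n → α) : ℝ :=
  ∏ i : Fin n, (noise i (past v i) (v i)).toReal

theorem sum_noiseWeight {α : Type*} [Fintype α] (noise : NoiseLaw α) (n : ℕ) :
    ∑ v : Fin n → α, noiseWeight noise v = 1 := by
  -- Truncation to length `0`, with a dummy second sequence.
  have h := sum_truncate (α := α) (β := Unit) (n := n)
    (fun i v _ => (noise i (past v (Fin.last i)) (v (Fin.last i))).toReal)
    (fun i v _ => by
      simp only [past_snoc, Fin.snoc_last, Finset.univ_unique, Finset.sum_const,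
        Finset.card_singleton, one_smul, PMF_sum_toReal])
    n.zero_le (fun _ _ => 1)
  simp only [one_mul, Finset.univ_unique, Finset.univ_eq_empty,
    Finset.prod_empty, Finset.sum_const, Finset.card_singleton, one_smul] at h
  exact h

section AdditiveLaw

variable {𝒳 : Type*} {G : Type*} [AddCommGroup G] [DecidableEq G] {𝒴 𝒱 : Finset G}

/-- The conditional law of `(X_i, Y_i)` given the past when the noise sequence is `v`. -/
def stepWeight (channel : Channel 𝒳 𝒴) {n : ℕ} (P : BlockInput 𝒳 ↥(𝒴 + 𝒱) n) (v : Fin n → 𝒱)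
    (i : Fin n) (x : Fin (i + 1) → 𝒳) (y : Fin (i + 1) → 𝒴) : ℝ :=
  (P i (past x (Fin.last i)) (addSeq (past y (Fin.last i)) (past v i)) (x (Fin.last i))).toReal *
    (channel i x (past y (Fin.last i)) (y (Fin.last i))).toReal

variable (channel : Channel 𝒳 𝒴) (noise : NoiseLaw 𝒱) {n : ℕ} (P : BlockInput 𝒳 ↥(𝒴 + 𝒱) n)

theorem additiveJointLaw_eq (x : Fin n → 𝒳) (y : Fin n → 𝒴) (v : Fin n → 𝒱) :
    additiveJointLaw channel noise P (x, y, v) =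
      noiseWeight noise v * ∏ i : Fin n, stepWeight channel P v i (upTo x i) (upTo y i) := by
  rw [noiseWeight, ← Finset.prod_mul_distrib]
  exact Finset.prod_congr rfl fun i _ => mul_comm _ _

theorem additiveJointLaw_nonneg (ω) : 0 ≤ additiveJointLaw channel noise P ω :=
  Finset.prod_nonneg fun i _ => by positivity

theorem stepWeight_snoc (v : Fin n → 𝒱) (i : Fin n) (x : Fin i → 𝒳) (y : Fin i → 𝒴) (a : 𝒳)
    (b : 𝒴) : stepWeight channel P v i (Fin.snoc x a) (Fin.snoc y b) =
      (P i x (addSeq y (past v i)) a).toReal * (channel i (Fin.snoc x a) y b).toReal := by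
  unfold stepWeight
  rw [past_snoc, past_snoc, Fin.snoc_last, Fin.snoc_last]

/-- The conditional law of `(X^i, Y^i)` given the noise sequence. -/
def prefixWeight (v : Fin n → 𝒱) (i : Fin n) (x : Fin (i + 1) → 𝒳) (y : Fin i → 𝒴) (b : 𝒴) : ℝ :=
  ∏ k : Fin (i + 1), stepWeight channel P v (Fin.castLE i.isLt k) (upTo x k)
    (upTo (Fin.snoc y b : Fin (i + 1) → 𝒴) k)

/-- The unit delay of the feedback: the step at time `k ≤ i` sees only the noise before `k`. -/
theorem prefixWeight_congr {v v' : Fin n → 𝒱} {i : Fin n} (h : past v i = past v' i)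
    (x : Fin (i + 1) → 𝒳) (y : Fin i → 𝒴) (b : 𝒴) :
    prefixWeight channel P v i x y b = prefixWeight channel P v' i x y b := by
  refine Finset.prod_congr rfl fun k _ => ?_
  unfold stepWeight
  rw [(past_eq_past_iff v v' _).2 fun j hj => (past_eq_past_iff v v' i).1 h j
    (hj.trans_le (Nat.lt_succ_iff.1 k.isLt))]

/-- The output at time `i` enters only the last channel factor; everything else is collected in `h`.
-/
theorem exists_prefixWeight_eq (v : Fin n → 𝒱) (i : Fin n) (x : Fin (i + 1) → 𝒳) (y : Fin i → 𝒴) :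
    ∃ h : ℝ, ∀ b, prefixWeight channel P v i x y b = h * (channel i x y b).toReal := by
  refine ⟨(∏ k : Fin i, stepWeight channel P v (Fin.castLE i.isLt k.castSucc) (upTo x k.castSucc)
    (upTo y k)) * (P i (past x (Fin.last i)) (addSeq y (past v i)) (x (Fin.last i))).toReal,
    fun b => ?_⟩
  unfold prefixWeight
  rw [Fin.prod_univ_castSucc, mul_assoc]
  congr 1
  · exact Finset.prod_congr rfl fun k _ => by rw [upTo_snoc]
  · change stepWeight channel P v i x (Fin.snoc y b) = _
    unfold stepWeight
    rw [past_snoc, Fin.snoc_last]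

variable [Fintype 𝒳]

theorem sum_stepWeight_snoc (v : Fin n → 𝒱) (i : Fin n) (x : Fin i → 𝒳) (y : Fin i → 𝒴) :
    ∑ a, ∑ b, stepWeight channel P v i (Fin.snoc x a) (Fin.snoc y b) = 1 := by
  simp only [stepWeight_snoc, ← Finset.mul_sum, PMF_sum_toReal, mul_one]

/-- The mass of an event that concerns the first `m` inputs and outputs and the whole noise. -/
theorem mass_additiveJointLaw {m : ℕ} (hm : m ≤ n) (p : (Fin m → 𝒳) → (Fin m → 𝒴) → Prop)
    [∀ x y, Decidable (p x y)] (v : Fin n → 𝒱) :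
    mass (additiveJointLaw channel noise P) (fun ω =>
      p (fun k => ω.1 (Fin.castLE hm k)) (fun k => ω.2.1 (Fin.castLE hm k)) ∧ ω.2.2 = v) =
      noiseWeight noise v * ∑ x, ∑ y, (if p x y then 1 else 0) *
        ∏ i : Fin m, stepWeight channel P v (Fin.castLE hm i) (upTo x i) (upTo y i) := by
  rw [← sum_truncate (stepWeight channel P v) (sum_stepWeight_snoc channel P v) hm
    (fun x y => if p x y then 1 else 0)]
  unfold mass
  simp only [Fintype.sum_prod_type, Finset.mul_sum]
  refine Finset.sum_congr rfl fun x _ => Finset.sum_congr rfl fun y _ => ?_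
  rw [Finset.sum_eq_single v]
  · rw [additiveJointLaw_eq]
    split_ifs <;> simp_all
  · intro b _ hb
    simp [hb]
  · simp

theorem mass_noise (v : Fin n → 𝒱) :
    mass (additiveJointLaw channel noise P) (fun ω => ω.2.2 = v) = noiseWeight noise v := by
  have h := mass_additiveJointLaw channel noise P n.zero_le (fun _ _ => True) v
  simpa using h

theorem mass_prefix (i : Fin n) (b : 𝒴) (c : (Fin (i + 1) → 𝒳) × (Fin i → 𝒴)) (v : Fin n → 𝒱) :
    mass (additiveJointLaw channel noise P)
      (fun ω => ω.2.1 i = b ∧ (upTo ω.1 i, past ω.2.1 i) = c ∧ ω.2.2 = v) =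
      noiseWeight noise v * prefixWeight channel P v i c.1 c.2 b := by
  classical
  have h := mass_additiveJointLaw channel noise P (Nat.succ_le_of_lt i.isLt)
    (fun x y => x = c.1 ∧ y = (Fin.snoc c.2 b : Fin (i + 1) → 𝒴)) v
  rw [Finset.sum_eq_single c.1 (fun x _ hx => by simp [hx]) (by simp),
    Finset.sum_eq_single (Fin.snoc c.2 b) (fun x _ hx => by simp [hx]) (by simp),
    if_pos ⟨rfl, rfl⟩, one_mul] at h
  refine Eq.trans (mass_congr _ fun ω => ?_) h
  refine Iff.trans ?_ (and_congr_left' (and_congr_right' (upTo_eq_snoc_iff ω.2.1 i c.2 b).symm))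
  simp only [Prod.ext_iff]
  tauto

theorem mass_prefix_output (i : Fin n) (b : 𝒴) (y : Fin i → 𝒴) (v : Fin n → 𝒱) :
    mass (additiveJointLaw channel noise P)
      (fun ω => ω.2.1 i = b ∧ past ω.2.1 i = y ∧ ω.2.2 = v) =
      noiseWeight noise v * ∑ x, prefixWeight channel P v i x y b := by
  rw [mass_eq_sum _ _ fun ω => upTo ω.1 i, Finset.mul_sum]
  refine Finset.sum_congr rfl fun x _ => ?_
  rw [← mass_prefix channel noise P i b (x, y) v]
  exact mass_congr _ fun ω => by simp only [Prod.mk_inj]; tauto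

variable {channel noise P}

/-- Given the past, the output does not depend on the present and future noise. -/
theorem condProb_noise_eq_past_noise (i : Fin n) {ω}
    (hω : 0 < additiveJointLaw channel noise P ω) :
    condProb (additiveJointLaw channel noise P) (fun ω => ω.2.1 i)
        (fun ω => (past ω.2.1 i, ω.2.2)) ω =
      condProb (additiveJointLaw channel noise P) (fun ω => ω.2.1 i)
        (fun ω => (past ω.2.1 i, past ω.2.2 i)) ω :=
  condProb_eq_of_factor (additiveJointLaw_nonneg channel noise P) (fun ω => ω.2.1 i)
    (fun ω => past ω.2.1 i) (fun ω => ω.2.2) (fun v => past v i) (noiseWeight noise)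
    (fun b y v => ∑ x, prefixWeight channel P v i x y b)
    (mass_prefix_output channel noise P i)
    (fun b y _ _ h => Finset.sum_congr rfl fun x _ => prefixWeight_congr channel P h x y b) hω

/-- Given the past and the inputs, the output does not depend on the present and future noise. -/
theorem condProb_input_noise_eq_past_noise (i : Fin n) {ω}
    (hω : 0 < additiveJointLaw channel noise P ω) :
    condProb (additiveJointLaw channel noise P) (fun ω => ω.2.1 i)
        (fun ω => ((upTo ω.1 i, past ω.2.1 i), ω.2.2)) ω =
      condProb (additiveJointLaw channel noise P) (fun ω => ω.2.1 i)
        (fun ω => ((upTo ω.1 i, past ω.2.1 i), past ω.2.2 i)) ω :=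
  condProb_eq_of_factor (additiveJointLaw_nonneg channel noise P) (fun ω => ω.2.1 i)
    (fun ω => (upTo ω.1 i, past ω.2.1 i)) (fun ω => ω.2.2) (fun v => past v i) (noiseWeight noise)
    (fun b c v => prefixWeight channel P v i c.1 c.2 b)
    (mass_prefix channel noise P i)
    (fun b c _ _ h => prefixWeight_congr channel P h c.1 c.2 b) hω

/-- The part of the weight that does not involve the output cancels, because the channel
probabilities sum to one. -/
theorem condProb_input_noise_eq_channel (i : Fin n) {ω}
    (hω : 0 < additiveJointLaw channel noise P ω) :
    condProb (additiveJointLaw channel noise P) (fun ω => ω.2.1 i)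
        (fun ω => ((upTo ω.1 i, past ω.2.1 i), ω.2.2)) ω =
      (channel i (upTo ω.1 i) (past ω.2.1 i) (ω.2.1 i)).toReal := by
  obtain ⟨h, hh⟩ := exists_prefixWeight_eq channel P ω.2.2 i (upTo ω.1 i) (past ω.2.1 i)
  have e : mass (additiveJointLaw channel noise P)
      (fun ω' => (upTo ω'.1 i, past ω'.2.1 i) = (upTo ω.1 i, past ω.2.1 i) ∧ ω'.2.2 = ω.2.2) =
      noiseWeight noise ω.2.2 * h := by
    rw [mass_eq_sum _ _ fun ω => ω.2.1 i]
    simp only [mass_prefix, hh]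
    rw [← Finset.mul_sum, ← Finset.mul_sum, PMF_sum_toReal, mul_one]
  have e₀ := mass_pos (additiveJointLaw_nonneg channel noise P) hω (p := fun ω' =>
    (upTo ω'.1 i, past ω'.2.1 i) = (upTo ω.1 i, past ω.2.1 i) ∧ ω'.2.2 = ω.2.2) ⟨rfl, rfl⟩
  rw [e] at e₀
  rw [condProb_eq_mass]
  simp only [Prod.mk_inj (a₁ := (upTo _ _, past _ _))]
  rw [mass_prefix, e, hh, ← mul_assoc, mul_div_cancel_left₀ _ e₀.ne']

end AdditiveLaw

/-! ### Passing from the feedback to the noise -/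

/-- The range of `φ` already carries the whole mass of `p`. Thus a link prescribed only at values `y
+ v` cannot emit anything else. -/
theorem PMF_mem_range_of_apply_eq {α β : Type*} [Fintype α] (p : PMF β) (q : PMF α) {φ : α → β}
    (hφ : Function.Injective φ) (h : ∀ a, p (φ a) = q a) {b : β} (hb : p b ≠ 0) :
    b ∈ Set.range φ := by
  classical
  by_contra hr
  have h₁ : ∑ c ∈ insert b (Finset.univ.image φ), p c ≤ 1 := by
    rw [← p.tsum_coe]
    exact ENNReal.sum_le_tsum _
  rw [Finset.sum_insert (by simpa using hr), Finset.sum_image hφ.injOn,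
    Finset.sum_congr rfl fun a _ => h a, ← tsum_fintype (L := .unconditional _), q.tsum_coe] at h₁
  exact hb (nonpos_iff_eq_zero.1 ((ENNReal.add_le_add_iff_right ENNReal.one_ne_top).1
    (by simpa using h₁)))

section Transfer

variable {𝒳 : Type*} {G : Type*} [AddCommGroup G] [DecidableEq G] {𝒴 𝒱 : Finset G}

theorem addSeq_right_injective {n : ℕ} (y : Fin n → 𝒴) :
    Function.Injective (addSeq y : (Fin n → 𝒱) → _) := fun v v' h => by
  funext i
  have := congrArg Subtype.val (congrFun h i)
  exact Subtype.ext (add_left_cancel this)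

/-- The outcome `(x, y, y + v)`. -/
def withFeedback {n : ℕ} (ω : (Fin n → 𝒳) × (Fin n → 𝒴) × (Fin n → 𝒱)) :
    (Fin n → 𝒳) × (Fin n → 𝒴) × (Fin n → ↥(𝒴 + 𝒱)) :=
  (ω.1, ω.2.1, addSeq ω.2.1 ω.2.2)

variable {channel : Channel 𝒳 𝒴} {link : FeedbackLink 𝒴 ↥(𝒴 + 𝒱)} {noise : NoiseLaw 𝒱}

/-- The present noise `u` is free, so the past is fixed while the whole conditional law is
described, as `PMF_mem_range_of_apply_eq` needs. -/
theorem IsAdditiveNoiseLink.apply_eq (hlink : IsAdditiveNoiseLink link noise) {n : ℕ}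
    (y : Fin n → 𝒴) (v : Fin n → 𝒱) (i : Fin n) (u : 𝒱) :
    link i (upTo y i) (past (addSeq y v) i) ⟨y i + u, Finset.add_mem_add (y i).2 u.2⟩ =
      noise i (past v i) u := by
  have h := hlink i (upTo y i) (Fin.snoc (past v i) u)
  have h₁ : past (addSeq (upTo y i) (Fin.snoc (past v i) u : Fin (i + 1) → 𝒱)) (Fin.last i) =
      past (addSeq y v) i := by
    change addSeq (past y i) (past (Fin.snoc (past v i) u) (Fin.last i)) = _
    rw [past_snoc]
    rfl
  have h₂ : addSeq (upTo y i) (Fin.snoc (past v i) u : Fin (i + 1) → 𝒱) (Fin.last i) =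
      ⟨y i + u, Finset.add_mem_add (y i).2 u.2⟩ := by
    refine Subtype.ext ?_
    change (y i : G) + ((Fin.snoc (past v i) u : Fin (i + 1) → 𝒱) (Fin.last i) : G) = _
    rw [Fin.snoc_last]
  rwa [h₁, h₂, past_snoc, Fin.snoc_last] at h

theorem jointLaw_withFeedback (hlink : IsAdditiveNoiseLink link noise) {n : ℕ}
    (P : BlockInput 𝒳 ↥(𝒴 + 𝒱) n) (ω) :
    jointLaw channel link P (withFeedback ω) = additiveJointLaw channel noise P ω := by
  refine Finset.prod_congr rfl fun i _ => ?_
  rw [← hlink.apply_eq ω.2.1 ω.2.2 i]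
  rfl

/-- Induction on time: the link is known only after a past of the form `y + v`, and there its
support consists of sums. -/
theorem exists_addSeq_eq (hlink : IsAdditiveNoiseLink link noise) {n : ℕ} (y : Fin n → 𝒴)
    (z : Fin n → ↥(𝒴 + 𝒱)) (h : ∀ i : Fin n, link i (upTo y i) (past z i) (z i) ≠ 0) :
    ∃ v, addSeq y v = z := by
  classical
  obtain ⟨d⟩ : Nonempty 𝒱 := ⟨(noise 0 Fin.elim0).support_nonempty.some⟩
  -- The induction shows that the default `d` is never used.
  let v : Fin n → 𝒱 := fun i => if hi : (z i : G) - y i ∈ 𝒱 then ⟨_, hi⟩ else d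
  refine ⟨v, funext fun ⟨i, hi⟩ => ?_⟩
  induction i using Nat.strong_induction_on with
  | _ i ih =>
    have hpast : past (addSeq y v) ⟨i, hi⟩ = past z ⟨i, hi⟩ :=
      (past_eq_past_iff _ _ _).2 fun k hk => ih k hk k.isLt
    obtain ⟨u, hu⟩ := PMF_mem_range_of_apply_eq _ _
      (fun u u' h => Subtype.ext (add_left_cancel (congrArg Subtype.val h)))
      (hlink.apply_eq y v ⟨i, hi⟩) (hpast ▸ h ⟨i, hi⟩)
    have hz : (z ⟨i, hi⟩ : G) - y ⟨i, hi⟩ = u := by rw [← hu, add_sub_cancel_left]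
    refine Subtype.ext ?_
    change (y ⟨i, hi⟩ : G) + (v ⟨i, hi⟩ : G) = _
    simp only [v]
    rw [dif_pos (hz ▸ u.2), add_sub_cancel]

theorem jointLaw_eq_zero (hlink : IsAdditiveNoiseLink link noise) {n : ℕ}
    (P : BlockInput 𝒳 ↥(𝒴 + 𝒱) n) {ω} (hω : ω ∉ Set.range withFeedback) :
    jointLaw channel link P ω = 0 := by
  by_contra h
  refine hω ?_
  obtain ⟨v, hv⟩ := exists_addSeq_eq hlink ω.2.1 ω.2.2 fun i hi => h <|
    Finset.prod_eq_zero (Finset.mem_univ i) (by simp [hi])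
  exact ⟨(ω.1, ω.2.1, v), by simp only [withFeedback, hv]⟩

variable [Fintype 𝒳]

/-- Change of variables along the injection `(x, y, v) ↦ (x, y, y + v)`; outcomes off its range have
zero mass, and `hF` removes them. -/
theorem sum_jointLaw (hlink : IsAdditiveNoiseLink link noise) {n : ℕ}
    (P : BlockInput 𝒳 ↥(𝒴 + 𝒱) n) (F : _ → ℝ → ℝ) (hF : ∀ ω, F ω 0 = 0) :
    ∑ ω, F ω (jointLaw channel link P ω) =
      ∑ ω, F (withFeedback ω) (additiveJointLaw channel noise P ω) := by
  refine (Fintype.sum_of_injective withFeedback (fun ω ω' h => ?_) _ _ (fun ω hω => ?_)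
    fun ω => ?_).symm
  · obtain ⟨x, y, v⟩ := ω
    obtain ⟨x', y', v'⟩ := ω'
    simp only [withFeedback, Prod.mk_inj] at h
    obtain ⟨rfl, rfl, h⟩ := h
    rw [addSeq_right_injective _ h]
  · rw [jointLaw_eq_zero hlink P hω, hF]
  · rw [jointLaw_withFeedback hlink]

theorem mass_jointLaw (hlink : IsAdditiveNoiseLink link noise) {n : ℕ}
    (P : BlockInput 𝒳 ↥(𝒴 + 𝒱) n) (p : _ → Prop) :
    mass (jointLaw channel link P) p =
      mass (additiveJointLaw channel noise P) fun ω => p (withFeedback ω) := by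
  classical
  unfold mass
  convert sum_jointLaw hlink P (fun ω r => if p ω then r else 0) (by simp)

theorem condProb_jointLaw (hlink : IsAdditiveNoiseLink link noise) {n : ℕ}
    (P : BlockInput 𝒳 ↥(𝒴 + 𝒱) n) {β γ : Type*}
    (B : (Fin n → 𝒳) × (Fin n → 𝒴) × (Fin n → ↥(𝒴 + 𝒱)) → β)
    (C : (Fin n → 𝒳) × (Fin n → 𝒴) × (Fin n → ↥(𝒴 + 𝒱)) → γ) (ω) :
    condProb (jointLaw channel link P) B C (withFeedback ω) =
      condProb (additiveJointLaw channel noise P) (B ∘ withFeedback) (C ∘ withFeedback) ω := by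
  rw [condProb_eq_mass, condProb_eq_mass, mass_jointLaw hlink, mass_jointLaw hlink]
  rfl

theorem past_addSeq_iff {n : ℕ} (y y' : Fin n → 𝒴) (v v' : Fin n → 𝒱) (i : Fin n) :
    past y i = past y' i ∧ past (addSeq y v) i = past (addSeq y' v') i ↔
      past y i = past y' i ∧ past v i = past v' i := by
  refine and_congr_right fun h => ?_
  change addSeq (past y i) (past v i) = addSeq (past y' i) (past v' i) ↔ _
  rw [h]
  exact (addSeq_right_injective _).eq_iff

/-- For every input distribution, causal conditioning on the feedback amounts to ordinary
conditioning on the noise. -/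
theorem causalCondDirectedInfo_eq (hlink : IsAdditiveNoiseLink link noise) {n : ℕ}
    (P : BlockInput 𝒳 ↥(𝒴 + 𝒱) n) :
    causalCondDirectedInfo (jointLaw channel link P) (fun ω => ω.1) (fun ω => ω.2.1)
        (fun ω => ω.2.2) =
      condDirectedInfo (additiveJointLaw channel noise P) (fun ω => ω.1) (fun ω => ω.2.1)
        (fun ω => ω.2.2) := by
  rw [condDirectedInfo_eq (additiveJointLaw_nonneg channel noise P)]
  unfold causalCondDirectedInfo
  refine (sum_jointLaw hlink P (fun ω r => r * Real.logb 2 _) fun ω => zero_mul _).trans ?_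
  refine Finset.sum_congr rfl fun ω _ => ?_
  rcases (additiveJointLaw_nonneg channel noise P ω).eq_or_lt with h | h
  · simp [← h]
  congr 3
  · refine Finset.prod_congr rfl fun i _ => ?_
    rw [condProb_input_noise_eq_past_noise i h, condProb_jointLaw hlink]
    refine condProb_congr_right _ _ fun ω' => ?_
    simp only [Function.comp, withFeedback, Prod.mk_inj, past_addSeq_iff, and_assoc]
  · refine Finset.prod_congr rfl fun i _ => ?_
    rw [condProb_noise_eq_past_noise i h, condProb_jointLaw hlink]
    refine condProb_congr_right _ _ fun ω' => ?_
    simp only [Function.comp, withFeedback, Prod.mk_inj, past_addSeq_iff]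

theorem causalRate_eq (hlink : IsAdditiveNoiseLink link noise)
    (P : (n : ℕ) → BlockInput 𝒳 ↥(𝒴 + 𝒱) n) :
    causalRate channel link P = noiseCondRate channel noise P := by
  simp only [causalRate, noiseCondRate, causalCondDirectedInfo_eq hlink]

end Transfer

/-! ### The input distribution of a uniformly distributed message -/

section MixedInput

variable {𝒳 𝒵 : Type*} {n M : ℕ} (f : Fin M → (i : Fin n) → (Fin i → 𝒵) → 𝒳)

open Classical in
/-- The messages whose code-functions produce the inputs `x` when the feedback is `z`. -/
def consistentMessages (i : Fin n) (x : Fin i → 𝒳) (z : Fin i → 𝒵) : Finset (Fin M) :=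
  {w | ∀ k : Fin i, f w (Fin.castLE i.isLt.le k) (past z k) = x k}

open Classical in
/-- The conditional law of the input given the past inputs and feedback when the message is
uniformly distributed. -/
def mixedInput [Nonempty 𝒳] : BlockInput 𝒳 𝒵 n := fun i x z =>
  if h : (consistentMessages f i x z).Nonempty then
    (PMF.uniformOfFinset _ h).map fun w => f w i z
  else PMF.pure (Classical.arbitrary 𝒳)

open Classical in
-- Multiplying by the cardinality covers the case of no consistent message, where both sides vanish.
theorem card_mul_mixedInput [Nonempty 𝒳] (i : Fin n) (x : Fin i → 𝒳) (z : Fin i → 𝒵) (a : 𝒳) :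
    ((consistentMessages f i x z).card : ℝ) * (mixedInput f i x z a).toReal =
      ((consistentMessages f i x z).filter fun w => f w i z = a).card := by
  unfold mixedInput
  split_ifs with h
  · have hc : ((consistentMessages f i x z).card : ℝ) ≠ 0 := by
      exact_mod_cast h.card_pos.ne'
    rw [PMF.map_apply, tsum_fintype, ENNReal.toReal_sum, Finset.mul_sum, Finset.card_filter,
      Nat.cast_sum, ← Finset.sum_subset (Finset.subset_univ (consistentMessages f i x z))]
    · refine Finset.sum_congr rfl fun w hw => ?_
      rw [PMF.uniformOfFinset_apply, if_pos hw]
      by_cases ha : f w i z = a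
      · simp [ha, hc]
      · simp [ha, Ne.symm ha]
    · intro w _ hw
      simp [PMF.uniformOfFinset_apply, hw]
    · intro w _
      split_ifs
      exacts [PMF.apply_ne_top _ _, ENNReal.zero_ne_top]
  · simp [Finset.not_nonempty_iff_eq_empty.1 h]

/-- The probability of the inputs `x`, causally conditioned on the feedback `z`. -/
def inputWeight (P : BlockInput 𝒳 𝒵 n) (x : Fin n → 𝒳) (z : Fin n → 𝒵) : ℝ :=
  ∏ i : Fin n, (P i (past x i) (past z i) (x i)).toReal

open Classical in
theorem inputWeight_codeFunctionInput (g : (i : Fin n) → (Fin i → 𝒵) → 𝒳) (x : Fin n → 𝒳)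
    (z : Fin n → 𝒵) : inputWeight (codeFunctionInput g) x z =
      if x = fun i => g i (past z i) then 1 else 0 := by
  unfold inputWeight codeFunctionInput
  simp only [PMF.pure_apply]
  split_ifs with h
  · exact Finset.prod_eq_one fun i _ => by simp [congrFun h i]
  · obtain ⟨i, hi⟩ := Function.ne_iff.1 h
    exact Finset.prod_eq_zero (Finset.mem_univ i) (by simp [hi])

/-- Each factor is a ratio of successive counts of consistent messages. The product telescopes from
`M` to the number of messages whose code-function yields all of `x`. -/
theorem inputWeight_mixedInput [Nonempty 𝒳] (x : Fin n → 𝒳) (z : Fin n → 𝒵) :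
    (M : ℝ) * inputWeight (mixedInput f) x z =
      ∑ w, inputWeight (codeFunctionInput (f w)) x z := by
  classical
  have h := prod_eq_of_telescope
    (fun m => (({w | ∀ k : Fin n, (k : ℕ) < m → f w k (past z k) = x k} : Finset (Fin M)).card : ℝ))
    (fun i => (mixedInput f i (past x i) (past z i) (x i)).toReal) fun i => by
      have e : ({w | ∀ k : Fin n, (k : ℕ) < i → f w k (past z k) = x k} : Finset (Fin M)) =
          consistentMessages f i (past x i) (past z i) := by
        ext w
        simp only [consistentMessages, Finset.mem_filter_univ]
        exact ⟨fun h k => h (Fin.castLE i.isLt.le k) k.isLt, fun h k hk => h ⟨k, hk⟩⟩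
      simp only [e]
      rw [card_mul_mixedInput, ← e, Finset.filter_filter]
      congr 2
      ext w
      simp only [Finset.mem_filter_univ]
      refine ⟨fun h => ⟨fun k hk => h k (Nat.lt_succ_of_lt hk), h i (Nat.lt_succ_self _)⟩,
        fun h k hk => ?_⟩
      rcases Nat.lt_succ_iff_lt_or_eq.1 hk with hk | hk
      · exact h.1 k hk
      · rw [Fin.ext hk]
        exact h.2
  simp only [Nat.not_lt_zero, false_imp_iff, implies_true, Finset.filter_true, Finset.card_univ,
    Fintype.card_fin, Fin.is_lt, forall_const] at h
  rw [inputWeight, ← h, Finset.card_filter, Nat.cast_sum]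
  refine Finset.sum_congr rfl fun w _ => ?_
  rw [inputWeight_codeFunctionInput, Nat.cast_ite, Nat.cast_one, Nat.cast_zero]
  exact if_congr ⟨fun h => funext fun i => (h i).symm, fun h i => (congrFun h i).symm⟩ rfl rfl

end MixedInput

/-! ### Fano's inequality -/

section Fano

variable {𝒳 : Type*} {G : Type*} [AddCommGroup G] [DecidableEq G] {𝒴 𝒱 : Finset G}
  {channel : Channel 𝒳 𝒴} {link : FeedbackLink 𝒴 ↥(𝒴 + 𝒱)} {noise : NoiseLaw 𝒱}

/-- The probability of the outputs `y`, causally conditioned on the inputs `x`. -/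
def channelWeight (channel : Channel 𝒳 𝒴) {n : ℕ} (x : Fin n → 𝒳) (y : Fin n → 𝒴) : ℝ :=
  ∏ i : Fin n, (channel i (upTo x i) (past y i) (y i)).toReal

theorem additiveJointLaw_eq_mul {n : ℕ} (P : BlockInput 𝒳 ↥(𝒴 + 𝒱) n) (ω) :
    additiveJointLaw channel noise P ω = inputWeight P ω.1 (addSeq ω.2.1 ω.2.2) *
      (channelWeight channel ω.1 ω.2.1 * noiseWeight noise ω.2.2) := by
  rw [inputWeight, channelWeight, noiseWeight, ← Finset.prod_mul_distrib,
    ← Finset.prod_mul_distrib]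
  exact Finset.prod_congr rfl fun i _ => mul_assoc _ _ _

theorem additiveJointLaw_mixedInput [Nonempty 𝒳] {n M : ℕ}
    (f : Fin M → (i : Fin n) → (Fin i → ↥(𝒴 + 𝒱)) → 𝒳) (ω) :
    (M : ℝ) * additiveJointLaw channel noise (mixedInput f) ω =
      ∑ w, additiveJointLaw channel noise (codeFunctionInput (f w)) ω := by
  simp only [additiveJointLaw_eq_mul]
  rw [← mul_assoc, inputWeight_mixedInput, Finset.sum_mul]

variable [Fintype 𝒳]

theorem sum_additiveJointLaw {n : ℕ} (P : BlockInput 𝒳 ↥(𝒴 + 𝒱) n) :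
    ∑ ω, additiveJointLaw channel noise P ω = 1 := by
  rw [← sum_noiseWeight noise n]
  simp only [← mass_noise channel noise P]
  have h : ∑ ω, additiveJointLaw channel noise P ω =
      mass (additiveJointLaw channel noise P) fun _ => True := by simp [mass]
  rw [h, mass_eq_sum _ _ fun ω => ω.2.2]
  exact Finset.sum_congr rfl fun v _ => mass_congr _ fun ω => by rw [and_true]

/-- The numerators are channel probabilities; the denominators multiply to `p(y | v)` by the chain
rule. -/
theorem condDirectedInfo_additiveJointLaw {n : ℕ} (P : BlockInput 𝒳 ↥(𝒴 + 𝒱) n) :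
    condDirectedInfo (additiveJointLaw channel noise P) (fun ω => ω.1) (fun ω => ω.2.1)
        (fun ω => ω.2.2) =
      ∑ ω, additiveJointLaw channel noise P ω * Real.logb 2
        (channelWeight channel ω.1 ω.2.1 * noiseWeight noise ω.2.2 /
          mass (additiveJointLaw channel noise P)
            fun ω' => ω'.2.1 = ω.2.1 ∧ ω'.2.2 = ω.2.2) := by
  have hμ := additiveJointLaw_nonneg channel noise P
  rw [condDirectedInfo_eq hμ]
  refine Finset.sum_congr rfl fun ω _ => ?_
  rcases (hμ ω).eq_or_lt with h | h
  · simp [← h]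
  rw [prod_condProb_eq hμ _ _ h, mass_noise, div_div_eq_mul_div,
    Finset.prod_congr rfl fun i _ => condProb_input_noise_eq_channel i h]
  rfl

variable [Nonempty 𝒳]

/-- Fano's inequality for the input distribution of a code. -/
theorem fano (hlink : IsAdditiveNoiseLink link noise) {n M : ℕ} (hM : 0 < M)
    (c : Code 𝒳 𝒴 ↥(𝒴 + 𝒱) n M) :
    (1 - c.avgError channel link) * Real.logb 2 M - 1 ≤
      condDirectedInfo (additiveJointLaw channel noise (mixedInput c.enc)) (fun ω => ω.1)
        (fun ω => ω.2.1) (fun ω => ω.2.2) := by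
  classical
  have hM' : (0 : ℝ) < M := Nat.cast_pos.2 hM
  set μ := additiveJointLaw channel noise (mixedInput c.enc) with hμ_def
  have hμ : ∀ ω, 0 ≤ μ ω := additiveJointLaw_nonneg _ _ _
  let law (w : Fin M) := additiveJointLaw channel noise (codeFunctionInput (c.enc w))
  have hlaw : ∀ w ω, 0 ≤ law w ω := fun w => additiveJointLaw_nonneg _ _ _
  have hlaw_eq : ∀ w ω, law w ω =
      (if ω.1 = fun i => c.enc w i (past (addSeq ω.2.1 ω.2.2) i) then 1 else 0) *
        (channelWeight channel ω.1 ω.2.1 * noiseWeight noise ω.2.2) := fun w ω => by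
    rw [← inputWeight_codeFunctionInput]
    exact additiveJointLaw_eq_mul _ _
  let p (y : Fin n → 𝒴) (v : Fin n → 𝒱) : ℝ := mass μ fun ω => ω.2.1 = y ∧ ω.2.2 = v
  -- The guess `q` mixes the decoder's decision and the uniform law in equal parts. It is always
  -- positive, and the mixing costs at most one bit.
  let q (w : Fin M) (y : Fin n → 𝒴) : ℝ := (if c.dec y = w then 1 / 2 else 0) + 1 / (2 * M)
  -- `ρ` is the true law of message, input, output and noise. The comparison law `t` draws `(y, v)`
  -- from its true marginal and `w` from `q`, and then lets the encoder fix `x`.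
  let ρ (a : Fin M × (Fin n → 𝒳) × (Fin n → 𝒴) × (Fin n → 𝒱)) : ℝ := 1 / M * law a.1 a.2
  let t (a : Fin M × (Fin n → 𝒳) × (Fin n → 𝒴) × (Fin n → 𝒱)) : ℝ :=
    (if a.2.1 = fun i => c.enc a.1 i (past (addSeq a.2.2.1 a.2.2.2) i) then 1 else 0) *
      (p a.2.2.1 a.2.2.2 * q a.1 a.2.2.1)
  have hp : ∀ y v, 0 ≤ p y v := fun y v => Finset.sum_nonneg fun ω _ => by
    split_ifs
    exacts [hμ ω, le_rfl]
  have hq : ∀ w y, 0 < q w y := fun w y => by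
    simp only [q]
    split_ifs <;> positivity
  have hμ_eq : ∀ ω, μ ω = ∑ w, ρ (w, ω) := fun ω => by
    simp only [ρ]
    rw [← Finset.mul_sum, ← additiveJointLaw_mixedInput]
    field_simp
    rfl
  have hρ : ∀ a, 0 ≤ ρ a := fun a => mul_nonneg (by positivity) (hlaw _ _)
  have hρμ : ∀ a, 0 < ρ a → 0 < p a.2.2.1 a.2.2.2 := fun a ha =>
    mass_pos hμ (ω := a.2) (ha.trans_le (by
      rw [hμ_eq]
      exact Finset.single_le_sum (f := fun w => ρ (w, a.2)) (fun w _ => hρ _)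
        (Finset.mem_univ a.1))) ⟨rfl, rfl⟩
  have hρ_ind : ∀ a, 0 < ρ a →
      a.2.1 = fun i => c.enc a.1 i (past (addSeq a.2.2.1 a.2.2.2) i) := fun a ha => by
    by_contra hne
    simp [ρ, hlaw_eq, hne] at ha
  have ht : ∀ a, 0 ≤ t a := fun a =>
    mul_nonneg (by split_ifs <;> norm_num) (mul_nonneg (hp _ _) (hq _ _).le)
  have hρt : ∀ a, 0 < ρ a → 0 < t a := fun a ha => by
    simp only [t]
    rw [if_pos (hρ_ind a ha), one_mul]
    exact mul_pos (hρμ a ha) (hq _ _)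
  have hρ_sum : ∑ a, ρ a = 1 := by
    rw [Fintype.sum_prod_type, Finset.sum_comm]
    simp only [← hμ_eq]
    exact sum_additiveJointLaw _
  have ht_sum : ∑ a, t a = 1 := by
    have h₁ : ∀ y, ∑ w, q w y = 1 := fun y => by
      simp only [q]
      rw [Finset.sum_add_distrib]
      simp
      field_simp
      norm_num
    have h₂ : ∑ y, ∑ v, p y v = 1 := by
      rw [← sum_additiveJointLaw (channel := channel) (noise := noise) (mixedInput c.enc)]
      have h := mass_eq_sum μ (fun _ => True) fun ω => ω.2
      simp only [Fintype.sum_prod_type, Prod.ext_iff, and_true] at h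
      rw [← h]
      simp [mass, μ]
    have h₃ : ∀ w, ∑ x, ∑ y, ∑ v, t (w, x, y, v) = ∑ y, ∑ v, p y v * q w y := fun w => by
      rw [Finset.sum_comm]
      refine Finset.sum_congr rfl fun y _ => ?_
      rw [Finset.sum_comm]
      refine Finset.sum_congr rfl fun v _ => ?_
      simp only [t]
      rw [← Finset.sum_mul, Finset.sum_ite_eq' Finset.univ, if_pos (Finset.mem_univ _), one_mul]
    rw [← h₂]
    simp only [Fintype.sum_prod_type, h₃]
    rw [Finset.sum_comm]
    refine Finset.sum_congr rfl fun y _ => ?_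
    rw [Finset.sum_comm]
    refine Finset.sum_congr rfl fun v _ => ?_
    rw [← Finset.mul_sum, h₁, mul_one]
  have hgibbs := sum_mul_logb_div_nonneg hρ ht hρt (ht_sum.trans hρ_sum.symm).le
  -- Where `ρ > 0` the encoder indicator is one, so `(ρ / t) * M * q` is exactly the ratio inside
  -- the information.
  have hinfo : condDirectedInfo μ (fun ω => ω.1) (fun ω => ω.2.1) (fun ω => ω.2.2) =
      ∑ a, ρ a * Real.logb 2 (ρ a / t a) + ∑ a, ρ a * Real.logb 2 (M * q a.1 a.2.2.1) := by
    rw [condDirectedInfo_additiveJointLaw, ← Finset.sum_add_distrib]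
    refine Eq.trans ?_ (Fintype.sum_prod_type_right _).symm
    refine Finset.sum_congr rfl fun ω _ => ?_
    rw [← hμ_def, hμ_eq, Finset.sum_mul]
    refine Finset.sum_congr rfl fun w _ => ?_
    rcases (hρ (w, ω)).eq_or_lt with h | h
    · simp [← h]
    rw [← mul_add, ← Real.logb_mul (div_pos h (hρt _ h)).ne' (mul_pos hM' (hq _ _)).ne']
    congr 2
    have hp' : p ω.2.1 ω.2.2 ≠ 0 := (hρμ _ h).ne'
    have hq' : q w ω.2.1 ≠ 0 := (hq _ _).ne'
    have hind := hρ_ind _ h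
    simp only [ρ, t, hlaw_eq]
    rw [if_pos hind]
    change _ / p ω.2.1 ω.2.2 = _
    field_simp
  -- `M q` is at least `M / 2` when decoding succeeds and equals `1 / 2` when it fails.
  have hpoint : ∀ a, ρ a * ((if c.dec a.2.2.1 = a.1 then 1 else 0) * Real.logb 2 M - 1) ≤
      ρ a * Real.logb 2 (M * q a.1 a.2.2.1) := fun a => by
    refine mul_le_mul_of_nonneg_left ?_ (hρ a)
    simp only [q]
    have hhalf : Real.logb 2 (1 / 2) = -1 := by
      rw [one_div, Real.logb_inv, Real.logb_self_eq_one one_lt_two]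
    split_ifs
    · rw [one_mul, sub_eq_add_neg, ← hhalf, ← Real.logb_mul hM'.ne' (by norm_num)]
      refine Real.logb_le_logb_of_le one_lt_two (by positivity) ?_
      gcongr
      exact le_add_of_nonneg_right (by positivity)
    · rw [zero_mul, zero_sub, ← hhalf]
      refine Real.logb_le_logb_of_le one_lt_two (by positivity) (le_of_eq ?_)
      field_simp
      ring
  have herr : ∑ a, ρ a * (if c.dec a.2.2.1 = a.1 then 1 else 0) = 1 - c.avgError channel link := by
    have h : c.avgError channel link = ∑ a, ρ a * (if c.dec a.2.2.1 ≠ a.1 then 1 else 0) := by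
      unfold Code.avgError
      rw [Fintype.sum_prod_type, Finset.mul_sum]
      refine Finset.sum_congr rfl fun w _ => ?_
      rw [sum_jointLaw hlink _ (fun ω r => if c.dec ω.2.1 ≠ w then r else 0) (by simp),
        Finset.mul_sum]
      refine Finset.sum_congr rfl fun ω _ => ?_
      simp only [withFeedback, ρ, law]
      by_cases hd : c.dec ω.2.1 = w <;> simp [hd]
    rw [h, eq_sub_iff_add_eq, ← Finset.sum_add_distrib]
    refine Eq.trans ?_ hρ_sum
    refine Finset.sum_congr rfl fun a _ => ?_
    by_cases hd : c.dec a.2.2.1 = a.1 <;> simp [hd]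
  calc (1 - c.avgError channel link) * Real.logb 2 M - 1
      = ∑ a, ρ a * ((if c.dec a.2.2.1 = a.1 then 1 else 0) * Real.logb 2 M - 1) := by
        simp only [mul_sub, mul_one, ← mul_assoc]
        rw [Finset.sum_sub_distrib, ← Finset.sum_mul, herr, hρ_sum]
    _ ≤ _ := Finset.sum_le_sum fun a _ => hpoint a
    _ ≤ _ := by
        rw [hinfo]
        exact le_add_of_nonneg_left hgibbs

/-- A rate that is achievable does not exceed the supremum of the information rates. -/
theorem achievable_le (hlink : IsAdditiveNoiseLink link noise) {R : ℝ}
    (hR : Achievable channel link R) :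
    (R : EReal) ≤ ⨆ P : (n : ℕ) → BlockInput 𝒳 ↥(𝒴 + 𝒱) n, noiseCondRate channel noise P := by
  classical
  obtain ⟨hR₀, hR⟩ := hR
  by_contra! hlt
  obtain ⟨r, hSr, hrR⟩ := EReal.lt_iff_exists_real_btwn.1 hlt
  rw [EReal.coe_lt_coe_iff] at hrR
  -- The right side is `R - ε (R + 2) + ε ^ 2`, so `ε (R + 2) ≤ R - r` suffices.
  obtain ⟨ε, hε, hε₁, hεr⟩ : ∃ ε : ℝ, 0 < ε ∧ ε ≤ 1 ∧ r ≤ (1 - ε) * (R - ε) - ε := by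
    have hR₂ : 0 < R + 2 := by linarith
    refine ⟨min 1 ((R - r) / (R + 2)), lt_min one_pos (div_pos (sub_pos.2 hrR) hR₂),
      min_le_left _ _, ?_⟩
    have h := (le_div_iff₀ hR₂).1 (min_le_right 1 ((R - r) / (R + 2)))
    nlinarith [sq_nonneg (min 1 ((R - r) / (R + 2)))]
  -- Stated as an implication, so that a distribution can be chosen at every horizon, including
  -- those without a good code. The condition `1 / n ≤ ε` absorbs the bit lost in `fano`.
  have hP : ∀ n : ℕ, ∃ P : BlockInput 𝒳 ↥(𝒴 + 𝒱) n,
      (∃ M : ℕ, 0 < M ∧ R - ε ≤ Real.logb 2 M / n ∧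
        ∃ c : Code 𝒳 𝒴 ↥(𝒴 + 𝒱) n M, c.avgError channel link ≤ ε) → 1 / (n : ℝ) ≤ ε →
      r ≤ 1 / (n : ℝ) * condDirectedInfo (additiveJointLaw channel noise P)
        (fun ω => ω.1) (fun ω => ω.2.1) (fun ω => ω.2.2) := fun n => by
    by_cases h : ∃ M : ℕ, 0 < M ∧ R - ε ≤ Real.logb 2 M / n ∧
        ∃ c : Code 𝒳 𝒴 ↥(𝒴 + 𝒱) n M, c.avgError channel link ≤ ε
    · obtain ⟨M, hM, hMR, c, hc⟩ := h
      refine ⟨mixedInput c.enc, fun _ hn => hεr.trans ?_⟩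
      have hlog : 0 ≤ Real.logb 2 M := Real.logb_nonneg one_lt_two (by exact_mod_cast hM)
      calc (1 - ε) * (R - ε) - ε ≤ (1 - ε) * (Real.logb 2 M / n) - 1 / n :=
            sub_le_sub (mul_le_mul_of_nonneg_left hMR (sub_nonneg.2 hε₁)) hn
        _ = 1 / (n : ℝ) * ((1 - ε) * Real.logb 2 M - 1) := by ring
        _ ≤ 1 / (n : ℝ) * ((1 - c.avgError channel link) * Real.logb 2 M - 1) := by gcongr
        _ ≤ _ := by gcongr; exact fano hlink hM c
    · exact ⟨fun _ _ _ => PMF.pure (Classical.arbitrary 𝒳), fun h' => absurd h' h⟩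
  choose P hP using hP
  refine hSr.not_ge (le_trans ?_ (le_iSup _ P))
  refine le_liminf_of_le (by isBoundedDefault) ?_
  have hn : ∀ᶠ n : ℕ in atTop, 1 / (n : ℝ) ≤ ε :=
    (tendsto_one_div_atTop_nhds_zero_nat (𝕜 := ℝ)).eventually_le_const hε
  filter_upwards [hR ε hε, hn] with n hc hn
  exact EReal.coe_le_coe_iff.2 (hP n hc hn)

end Fano

end NoisyFeedback

end

theorem corollary3 {𝒳 : Type*} [Fintype 𝒳] [Nonempty 𝒳]
    {G : Type*} [AddCommGroup G] [DecidableEq G] (𝒴 𝒱 : Finset G)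
    (channel : NoisyFeedback.Channel 𝒳 𝒴)
    (link : NoisyFeedback.FeedbackLink 𝒴 ↥(𝒴 + 𝒱))
    (noise : NoisyFeedback.NoiseLaw 𝒱)
    (hlink : NoisyFeedback.IsAdditiveNoiseLink link noise) :
    -- the causally conditioned quantity bounds the capacity from above
    NoisyFeedback.capacity channel link ≤
      (⨆ P : (n : ℕ) → NoisyFeedback.BlockInput 𝒳 ↥(𝒴 + 𝒱) n,
        NoisyFeedback.causalRate channel link P) ∧
    -- and this bound can be computed with ordinary conditioning on the noise
    (⨆ P : (n : ℕ) → NoisyFeedback.BlockInput 𝒳 ↥(𝒴 + 𝒱) n,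
        NoisyFeedback.causalRate channel link P) =
      (⨆ P : (n : ℕ) → NoisyFeedback.BlockInput 𝒳 ↥(𝒴 + 𝒱) n,
        NoisyFeedback.noiseCondRate channel noise P) ∧
    -- likewise with one input distribution that serves all time horizons
    (⨆ P : NoisyFeedback.SeqInput 𝒳 ↥(𝒴 + 𝒱),
        NoisyFeedback.causalRate channel link P.block) =
      (⨆ P : NoisyFeedback.SeqInput 𝒳 ↥(𝒴 + 𝒱),
        NoisyFeedback.noiseCondRate channel noise P.block) := by
  refine ⟨?_, ?_, ?_⟩
  · simp only [NoisyFeedback.causalRate_eq hlink]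
    exact iSup_le fun R => NoisyFeedback.achievable_le hlink R.2
  · simp only [NoisyFeedback.causalRate_eq hlink]
  · simp only [NoisyFeedback.causalRate_eq hlink]
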